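/- Let $n\ge 2$ and $1\le i\le n$, and let $A,B\subset\mathbb R^n$ be convex bodies, that is, compact convex sets with non-empty interior. A fractional linear (projective) map is a map of the form $$F(x)=\frac{Lx+b}{\langle x,c\rangle+d},$$ where $L$ is a linear operator on $\mathbb R^n$, $b,c\in\mathbb R^n$ and $d\in\mathbb R$ are such that the matrix $\begin{pmatrix}L&b\\ c&d\end{pmatrix}$ is invertible (affine maps, $c=0$, are included). Its domain is taken to be an open half-space bounded by the hyperplane $\{x:\langle x,c\rangle+d=0\}$ (all of $\mathbb R^n$ if $c=0$), and $F$ is called admissible if $A$ and $B$ are both contained in its domain, i.e. if $\langle x,c\rangle+d$ is non-zero and of one constant sign on $A\cup B$. Let $D_n$ be the closed Euclidean unit ball of $\mathbb R^n$ and, for a convex body $K$, let $$W_{n-i}(K)=V(\underbrace{K,\dots,K}_{i},\underbrace{D_n,\dots,D_n}_{n-i})$$ be the quermassintegral, where $V(K_1,\dots,K_n)=\frac1{n!}\sum_{S\subseteq\{1,\dots,n\}}(-1)^{n-|S|}\operatorname{Vol}\bigl(\sum_{k\in S}K_k\bigr)$ denotes the $n$-dimensional mixed volume. If $$W_{n-i}(F(A))\le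 W_{n-i}(F(B))$$ for every admissible fractional linear map $F$, then $A\subseteq B$. -/

import Mathlib

open scoped Pointwise

/-- A fractional linear map of `ℝⁿ`, given by its data `(A, b, c, d)`: a linear operator `A`, vectors
`b`, `c` and a number `d` such that the linear map of `ℝⁿ × ℝ` with the block matrix
`(A b; c d)` is invertible. -/
structure FractionalLinearMap (n : ℕ) where
  /-- the linear operator `A` -/
  linear : EuclideanSpace ℝ (Fin n) →ₗ[ℝ] EuclideanSpace ℝ (Fin n)
  /-- the vector `b` -/
  shift : EuclideanSpace ℝ (Fin n)
  /-- the vector `c` -/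
  normal : EuclideanSpace ℝ (Fin n)
  /-- the number `d` -/
  const : ℝ
  /-- the block matrix `(A b; c d)` is invertible -/
  invertible : Function.Bijective
    (fun p : EuclideanSpace ℝ (Fin n) × ℝ =>
      (linear p.1 + p.2 • shift, inner ℝ p.1 normal + const * p.2))

namespace FractionalLinearMap

variable {n : ℕ}

/-- The denominator `⟨x, c⟩ + d`. -/
noncomputable def denom (F : FractionalLinearMap n) (x : EuclideanSpace ℝ (Fin n)) : ℝ :=
  inner ℝ x F.normal + F.const

/-- The map `x ↦ (A x + b) / (⟨x, c⟩ + d)` (meaningful where the denominator is non-zero). -/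
noncomputable def toFun (F : FractionalLinearMap n) (x : EuclideanSpace ℝ (Fin n)) :
    EuclideanSpace ℝ (Fin n) :=
  (F.denom x)⁻¹ • (F.linear x + F.shift)

/-- The domain: the open half-space `{x | ⟨x, c⟩ + d > 0}` on one side of the defining hyperplane
`{x | ⟨x, c⟩ + d = 0}`, and all of `ℝⁿ` for an affine map (`c = 0`, `d > 0`). The other side is
covered by the data `(-A, -b, -c, -d)`, which give the same map. -/
def Dom (F : FractionalLinearMap n) : Set (EuclideanSpace ℝ (Fin n)) :=
  {x | 0 < F.denom x}

/-- `F` is admissible for `A` and `B` if both lie in its domain. -/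
def Admissible (F : FractionalLinearMap n) (A B : Set (EuclideanSpace ℝ (Fin n))) : Prop :=
  A ⊆ F.Dom ∧ B ⊆ F.Dom

end FractionalLinearMap

/-- The mixed volume `V(K₁, …, Kₙ)` in `ℝⁿ`, as the polarization of the volume functional under
Minkowski addition:
`V(K₁, …, Kₙ) = (1 / n!) ∑_{S ⊆ {1, …, n}} (-1)^(n - |S|) Vol (∑_{k ∈ S} K_k)`.
For convex bodies, `n! V(K₁, …, Kₙ)` is the coefficient of `λ₁ ⋯ λₙ` in the polynomial
`Vol (λ₁ K₁ + ⋯ + λₙ Kₙ)`. -/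
noncomputable def mixedVolume {n : ℕ} (K : Fin n → Set (EuclideanSpace ℝ (Fin n))) : ℝ :=
  (1 / (n.factorial : ℝ)) *
    ∑ S : Finset (Fin n), (-1 : ℝ) ^ (n - S.card) * MeasureTheory.volume.real (∑ k ∈ S, K k)

/-- The quermassintegral `W_j(K) = V(K[n - j], D_n[j])` for `j ≤ n`, with `D_n` the closed Euclidean
unit ball: the first `n - j` arguments are `K`, the last `j` are `D_n`. -/
noncomputable def quermassintegral {n : ℕ} (j : ℕ) (K : Set (EuclideanSpace ℝ (Fin n))) : ℝ :=
  mixedVolume (fun k : Fin n =>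
    if (k : ℕ) < n - j then K else Metric.closedBall (0 : EuclideanSpace ℝ (Fin n)) 1)

open MeasureTheory Metric Filter Topology

/-! Two degenerations reduce the claim to volumes of coordinate projections and then contradict it.

Affine degeneration: stretch the first `i` coordinates by `1/t` and shrink the rest by `t`. As `t →
0`, `t ^ i` times the quermassintegral of the stretched body tends to a positive constant times the
`i`-dimensional volume of the projection to the first `i` coordinates
(`tendsto_quermassintegral_stretch`). Composing an admissible map with the stretch keeps it
admissible, so the hypothesis passes to the volumes of the projections of `F(A)` and `F(B)`
(`volume_restrictCoords_image_le`).

Projective degeneration: if some point of `A` lies outside `B`, a direction exists in which the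
lowest point `p` of `A` lies strictly below all of `B`. Take a projective map whose singular
hyperplane passes at distance `ε` below `p`, with its first coordinate scaled by `ε`. It flattens
`B` to thickness `O(ε)` (`volume_perspective_image_le`), while the part of `A` at distance of order
`ε` from `p` is blown up to contain a fixed box (`le_volume_perspective_image`). For small `ε` the
projection of `F(A)` has the larger volume, a contradiction. -/

/-! ### Polarization: Minkowski sums and alternating sums over subsets -/

theorem Convex.sum_ite_eq_smul_add_smul {E ι : Type*} [AddCommGroup E] [Module ℝ E]
    {K D : Set E} (hK : Convex ℝ K) (hD : Convex ℝ D) (hK0 : K.Nonempty) (hD0 : D.Nonempty)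
    (P : ι → Prop) [DecidablePred P] [DecidableEq ι] (S : Finset ι) :
    ∑ k ∈ S, (if P k then K else D) =
      ((S.filter P).card : ℝ) • K + ((S.filter fun k => ¬ P k).card : ℝ) • D := by
  induction S using Finset.induction_on with
  -- Non-emptiness matters here: a zero coefficient must give `{0}`, not the empty set.
  | empty => simp [Set.zero_smul_set hK0, Set.zero_smul_set hD0]
  | insert a S ha ih =>
    rw [Finset.sum_insert ha, ih, Finset.filter_insert, Finset.filter_insert]
    by_cases h : P a
    · rw [if_pos h, if_pos h, if_neg (not_not.mpr h), Finset.card_insert_of_notMem (by simp [ha]),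
        Nat.cast_add, hK.add_smul (Nat.cast_nonneg _) (Nat.cast_nonneg _), Nat.cast_one, one_smul,
        ← add_assoc, add_comm K]
    · rw [if_neg h, if_neg h, if_pos h, Finset.card_insert_of_notMem (by simp [ha]),
        Nat.cast_add, hD.add_smul (Nat.cast_nonneg _) (Nat.cast_nonneg _), Nat.cast_one, one_smul,
        add_left_comm, add_comm D]

/-- Grouped by cardinality, the sum is the `N`-th forward difference of `x ^ N` at `0`, where `N` is
the cardinality of `α`. -/
theorem sum_finset_neg_one_pow_mul_card_pow (α : Type*) [Fintype α] :
    ∑ S : Finset α, (-1 : ℝ) ^ (Fintype.card α - S.card) * (S.card : ℝ) ^ Fintype.card α =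
      (Fintype.card α).factorial := by
  classical
  have h := congrFun (fwdDiff_iter_eq_factorial (R := ℝ) (n := Fintype.card α)) 0
  rw [fwdDiff_iter_eq_sum_shift] at h
  have h2 := Finset.sum_powerset_apply_card (x := (Finset.univ : Finset α))
    (fun m => (-1 : ℝ) ^ (Fintype.card α - m) * (m : ℝ) ^ Fintype.card α)
  rw [Finset.powerset_univ] at h2
  rw [h2, Finset.card_univ]
  simp only [zero_add, nsmul_eq_mul, mul_one, zsmul_eq_mul] at h
  rw [Pi.natCast_apply] at h
  rw [← h]
  refine Finset.sum_congr rfl fun m _ => ?_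
  push_cast
  ring

/-- A subset is a pair of subsets, inside and outside `P`, so the sum factors into two instances of
the previous identity. It evaluates the polarization of a volume that has become a single monomial
in the two coefficients. -/
theorem sum_finset_neg_one_pow_mul_card_filter_pow {ι : Type*} [Fintype ι]
    (P : ι → Prop) [DecidablePred P] :
    ∑ S : Finset ι, (-1 : ℝ) ^ (Fintype.card ι - S.card) *
        (((S.filter P).card : ℝ) ^ Fintype.card {k // P k} *
          ((S.filter fun k => ¬ P k).card : ℝ) ^ Fintype.card {k // ¬ P k}) =
      (Fintype.card {k // P k}).factorial * (Fintype.card {k // ¬ P k}).factorial := by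
  classical
  rw [← sum_finset_neg_one_pow_mul_card_pow, ← sum_finset_neg_one_pow_mul_card_pow,
    Finset.sum_mul_sum, ← Finset.sum_product']
  let e : Finset ι ≃ Finset {k // P k} × Finset {k // ¬ P k} :=
    ((Equiv.sumCompl P).symm.finsetCongr).trans Finset.sumEquiv.toEquiv
  refine Fintype.sum_equiv e _ _ fun S => ?_
  have h1 : (e S).1.card = (S.filter P).card := by
    rw [← Finset.card_subtype]
    congr 1
    ext k
    simp [e, Finset.sumEquiv, Equiv.sumCompl]
  have h2 : (e S).2.card = (S.filter fun k => ¬ P k).card := by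
    rw [← Finset.card_subtype]
    congr 1
    ext k
    simp [e, Finset.sumEquiv, Equiv.sumCompl]
  have h3 : S.card = (S.filter P).card + (S.filter fun k => ¬ P k).card :=
    (Finset.card_filter_add_card_filter_not (s := S) P).symm
  have h4 : (S.filter P).card ≤ Fintype.card {k // P k} := h1 ▸ Finset.card_le_univ _
  have h5 : (S.filter fun k => ¬ P k).card ≤ Fintype.card {k // ¬ P k} :=
    h2 ▸ Finset.card_le_univ _
  have h6 : Fintype.card ι = Fintype.card {k // P k} + Fintype.card {k // ¬ P k} := by
    rw [← Fintype.card_sum]; exact Fintype.card_congr (Equiv.sumCompl P).symm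
  have h7 : Fintype.card ι - S.card = (Fintype.card {k // P k} - (S.filter P).card) +
      (Fintype.card {k // ¬ P k} - (S.filter fun k => ¬ P k).card) := by omega
  rw [h7, pow_add, h1, h2]
  ring

/-! ### Volume of a stretched body plus a ball -/

section SplitCoordinates

variable {ι : Type*} (P : ι → Prop)

/-- The coordinates in `P`. -/
def restrictCoords (x : EuclideanSpace ℝ ι) : {k // P k} → ℝ := fun k => x k

theorem continuous_restrictCoords : Continuous (restrictCoords (ι := ι) P) := by
  unfold restrictCoords; fun_prop

variable [DecidablePred P]

/-- The vector with given coordinates in `P` and outside of `P`. -/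
noncomputable def joinCoords (z : ({k // P k} → ℝ) × EuclideanSpace ℝ {k // ¬ P k}) :
    EuclideanSpace ℝ ι :=
  WithLp.toLp 2 fun k => if h : P k then z.1 ⟨k, h⟩ else z.2 ⟨k, h⟩

/-- The coordinates outside of `P`, with the Euclidean norm. -/
noncomputable def restrictCompl (x : EuclideanSpace ℝ ι) : EuclideanSpace ℝ {k // ¬ P k} :=
  WithLp.toLp 2 fun k => x k

/-- The linear map that multiplies the coordinates in `P` by `t⁻¹` and the others by `t`. -/
noncomputable def stretch (t : ℝ) : EuclideanSpace ℝ ι →ₗ[ℝ] EuclideanSpace ℝ ι where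
  toFun x := WithLp.toLp 2 fun k => (if P k then t⁻¹ else t) * x k
  map_add' x y := by ext k; simp [mul_add]
  map_smul' c x := by ext k; simp [mul_left_comm]

variable {P}

@[simp] theorem stretch_apply (t : ℝ) (x : EuclideanSpace ℝ ι) (k : ι) :
    stretch P t x k = (if P k then t⁻¹ else t) * x k := rfl

theorem stretch_injective {t : ℝ} (ht : t ≠ 0) :
    Function.Injective (stretch P t : EuclideanSpace ℝ ι → EuclideanSpace ℝ ι) := by
  intro x y hxy
  ext k
  have h : stretch P t x k = stretch P t y k := by rw [hxy]
  rw [stretch_apply, stretch_apply] at h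
  refine mul_left_cancel₀ ?_ h
  split_ifs
  exacts [inv_ne_zero ht, ht]

theorem continuous_joinCoords : Continuous (joinCoords (ι := ι) P) := by
  unfold joinCoords
  refine (PiLp.continuous_toLp 2 _).comp (continuous_pi fun k => ?_)
  by_cases h : P k
  · simp only [h, dite_true]; fun_prop
  · simp only [h, dite_false]; fun_prop

theorem restrictCoords_joinCoords (z : ({k // P k} → ℝ) × EuclideanSpace ℝ {k // ¬ P k}) :
    restrictCoords P (joinCoords P z) = z.1 := by
  ext k; simp [restrictCoords, joinCoords, k.2]

theorem restrictCompl_joinCoords (z : ({k // P k} → ℝ) × EuclideanSpace ℝ {k // ¬ P k}) :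
    restrictCompl P (joinCoords P z) = z.2 := by
  ext k; simp [restrictCompl, joinCoords, k.2]

variable [Fintype ι]

theorem norm_restrictCompl_le (x : EuclideanSpace ℝ ι) : ‖restrictCompl P x‖ ≤ ‖x‖ := by
  rw [EuclideanSpace.norm_eq, EuclideanSpace.norm_eq]
  refine Real.sqrt_le_sqrt ?_
  rw [← Fintype.sum_subtype_add_sum_subtype P fun k => ‖x k‖ ^ 2]
  exact le_add_of_nonneg_left (Finset.sum_nonneg fun _ _ => by positivity)

theorem norm_restrictCoords_le (x : EuclideanSpace ℝ ι) : ‖restrictCoords P x‖ ≤ ‖x‖ :=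
  (pi_norm_le_iff_of_nonneg (norm_nonneg _)).2 fun k => PiLp.norm_apply_le x k

theorem norm_joinCoords_zero (y : EuclideanSpace ℝ {k // ¬ P k}) :
    ‖joinCoords P (0, y)‖ = ‖y‖ := by
  rw [EuclideanSpace.norm_eq, EuclideanSpace.norm_eq,
    ← Fintype.sum_subtype_add_sum_subtype P fun k => ‖joinCoords P (0, y) k‖ ^ 2]
  have h1 : ∀ k : {k // P k}, joinCoords P (0, y) k = 0 := fun k => by simp [joinCoords, k.2]
  have h2 : ∀ k : {k // ¬ P k}, joinCoords P (0, y) k = y k := fun k => by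
    simp [joinCoords, k.2]
  simp [h1, h2]

theorem measurePreserving_joinCoords : MeasurePreserving (joinCoords (ι := ι) P) := by
  have h1 := (volume_preserving_piEquivPiSubtypeProd (fun _ : ι => ℝ) P).symm
  have h2 := PiLp.volume_preserving_toLp ι
  have h3 : MeasurePreserving (Prod.map id WithLp.ofLp :
      ({k // P k} → ℝ) × EuclideanSpace ℝ {k // ¬ P k} → ({k // P k} → ℝ) × ({k // ¬ P k} → ℝ)) :=
    (MeasurePreserving.id _).prod (PiLp.volume_preserving_ofLp _)
  exact (h2.comp h1).comp h3

variable {K : Set (EuclideanSpace ℝ ι)}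

theorem IsCompact.smul_image_add_closedBall (hK : IsCompact K) (t p q : ℝ) :
    IsCompact (p • (stretch P t '' K) + closedBall 0 q) := by
  refine IsCompact.add (IsCompact.smul p (hK.image ?_)) (isCompact_closedBall 0 q)
  exact LinearMap.continuous_of_finiteDimensional _

/-- Fubini: over each point of the projection of the stretched body, the slice of the sum contains a
full ball of radius `q`. -/
theorem le_volume_smul_image_stretch_add (hK : IsCompact K) {t p q : ℝ} (ht : 0 < t)
    (hp : 0 ≤ p) (hq : 0 ≤ q) :
    p ^ Fintype.card {k // P k} * volume.real (restrictCoords P '' K) *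
        (q ^ Fintype.card {k // ¬ P k} *
          volume.real (ball (0 : EuclideanSpace ℝ {k // ¬ P k}) 1)) ≤
      t ^ Fintype.card {k // P k} *
        volume.real (p • (stretch P t '' K) + closedBall 0 q) := by
  set X := p • (stretch P t '' K) + closedBall 0 q with hX
  have hXc : IsCompact X := hK.smul_image_add_closedBall t p q
  have hXm : MeasurableSet X := hXc.measurableSet
  set U : Set ({k // P k} → ℝ) := (t⁻¹ * p) • (restrictCoords P '' K) with hU
  have hUm : MeasurableSet U :=
    (IsCompact.smul _ (hK.image (continuous_restrictCoords P))).measurableSet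
  set c := volume (closedBall (0 : EuclideanSpace ℝ {k // ¬ P k}) q)
  have key : volume U * c ≤ volume X := by
    rw [← measurePreserving_joinCoords (P := P).measure_preimage hXm.nullMeasurableSet,
      Measure.volume_eq_prod,
      Measure.prod_apply (continuous_joinCoords.measurable hXm), mul_comm,
      ← lintegral_indicator_const hUm]
    refine lintegral_mono fun u => ?_
    by_cases hu : u ∈ U
    swap
    · rw [Set.indicator_of_notMem hu]; exact zero_le
    rw [Set.indicator_of_mem hu]
    obtain ⟨_, ⟨x, hx, rfl⟩, rfl⟩ := hu
    -- The volume of a ball does not depend on its centre, so it may be centred at the point of the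
    -- slice that comes from `x`.
    rw [show c = volume (closedBall ((p * t) • restrictCompl P x) q) 
      from (Measure.addHaar_closedBall_center _ _ _).symm]
    refine measure_mono fun y hy => ?_
    refine Set.mem_add.2 ⟨p • stretch P t x, ⟨_, ⟨x, hx, rfl⟩, rfl⟩,
      joinCoords P (0, y - (p * t) • restrictCompl P x), ?_, ?_⟩
    · rw [mem_closedBall_zero_iff, norm_joinCoords_zero, ← dist_eq_norm]
      exact hy
    · ext k
      by_cases h : P k
      · simp [joinCoords, h, restrictCoords]; ring
      · simp [joinCoords, h, restrictCompl]; ring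
  have key2 := ENNReal.toReal_mono hXc.measure_ne_top key
  rw [ENNReal.toReal_mul, hU, Measure.addHaar_smul_of_nonneg _ (by positivity),
    ENNReal.toReal_mul, ENNReal.toReal_ofReal (by positivity)] at key2
  have hc : c.toReal = q ^ Fintype.card {k // ¬ P k} *
      volume.real (ball (0 : EuclideanSpace ℝ {k // ¬ P k}) 1) := by
    have := Measure.addHaar_real_closedBall volume (0 : EuclideanSpace ℝ {k // ¬ P k}) hq
    rwa [finrank_euclideanSpace] at this
  rw [hc, Module.finrank_fintype_fun_eq_card] at key2
  refine le_trans (le_of_eq ?_) (mul_le_mul_of_nonneg_left key2 (by positivity))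
  rw [mul_pow, inv_pow, measureReal_def]
  field_simp

/-- The sum lies in a product. After rescaling the coordinates in `P` by `t`, the added ball
contributes only a thickening by `t * q`; in the other coordinates the body has shrunk to size `p *
t * R`. -/
theorem volume_smul_image_stretch_add_le (hK : IsCompact K) {t p q R : ℝ} (ht : 0 < t)
    (hp : 0 ≤ p) (hq : 0 ≤ q) (hR0 : 0 ≤ R) (hR : ∀ x ∈ K, ‖x‖ ≤ R) :
    t ^ Fintype.card {k // P k} *
        volume.real (p • (stretch P t '' K) + closedBall 0 q) ≤
      volume.real (cthickening (t * q) (p • (restrictCoords P '' K))) *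
        ((p * t * R + q) ^ Fintype.card {k // ¬ P k} *
          volume.real (ball (0 : EuclideanSpace ℝ {k // ¬ P k}) 1)) := by
  set X := p • (stretch P t '' K) + closedBall 0 q with hX
  have hXm : MeasurableSet X := (hK.smul_image_add_closedBall t p q).measurableSet
  have hKP : IsCompact (p • (restrictCoords P '' K)) :=
    IsCompact.smul p (hK.image (continuous_restrictCoords P))
  set V := cthickening (t * q) (p • (restrictCoords P '' K)) with hV
  have hVc : IsCompact V := hKP.cthickening
  set c := volume (closedBall (0 : EuclideanSpace ℝ {k // ¬ P k}) (p * t * R + q)) with hc'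
  have key : volume X ≤ volume (t⁻¹ • V) * c := by
    rw [← measurePreserving_joinCoords (P := P).measure_preimage hXm.nullMeasurableSet,
      Measure.volume_eq_prod, hc', ← Measure.prod_prod]
    refine measure_mono ?_
    rintro z ⟨_, ⟨_, ⟨x, hx, rfl⟩, rfl⟩, d, hd, hz⟩
    rw [mem_closedBall_zero_iff] at hd
    have hz1 : z.1 = (p * t⁻¹) • restrictCoords P x + restrictCoords P d := by
      rw [← restrictCoords_joinCoords (P := P) z, ← hz]
      ext k; simp [restrictCoords, k.2, mul_assoc]
    have hz2 : z.2 = (p * t) • restrictCompl P x + restrictCompl P d := by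
      rw [← restrictCompl_joinCoords (P := P) z, ← hz]
      ext k; simp [restrictCompl, k.2, mul_assoc]
    refine ⟨(Set.mem_inv_smul_set_iff₀ ht.ne' _ _).2 ?_, ?_⟩
    · refine mem_cthickening_of_dist_le _ (p • restrictCoords P x) _ _
        ⟨_, ⟨x, hx, rfl⟩, rfl⟩ ?_
      have : t • z.1 - p • restrictCoords P x = t • restrictCoords P d := by
        rw [hz1, smul_add, smul_smul, mul_left_comm, mul_inv_cancel₀ ht.ne', mul_one,
          add_sub_cancel_left]
      rw [dist_eq_norm, this, norm_smul, Real.norm_of_nonneg ht.le]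
      exact mul_le_mul_of_nonneg_left ((norm_restrictCoords_le d).trans hd) ht.le
    · rw [mem_closedBall_zero_iff, hz2]
      refine (norm_add_le _ _).trans (add_le_add ?_ ((norm_restrictCompl_le d).trans hd))
      rw [norm_smul, Real.norm_of_nonneg (by positivity)]
      exact mul_le_mul_of_nonneg_left ((norm_restrictCompl_le x).trans (hR x hx)) (by positivity)
  have hVfin : volume (t⁻¹ • V) ≠ ⊤ := (hVc.smul _).measure_ne_top
  have key2 := ENNReal.toReal_mono
    (ENNReal.mul_ne_top hVfin (isCompact_closedBall _ _).measure_ne_top) key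
  rw [ENNReal.toReal_mul, Measure.addHaar_smul_of_nonneg _ (by positivity),
    ENNReal.toReal_mul, ENNReal.toReal_ofReal (by positivity)] at key2
  have hc : c.toReal = (p * t * R + q) ^ Fintype.card {k // ¬ P k} *
      volume.real (ball (0 : EuclideanSpace ℝ {k // ¬ P k}) 1) := by
    have := Measure.addHaar_real_closedBall volume (0 : EuclideanSpace ℝ {k // ¬ P k})
      (r := p * t * R + q) (by positivity)
    rwa [finrank_euclideanSpace] at this
  rw [hc, Module.finrank_fintype_fun_eq_card] at key2
  refine (mul_le_mul_of_nonneg_left key2 (by positivity)).trans (le_of_eq ?_)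
  rw [inv_pow, measureReal_def (s := V)]
  field_simp

theorem tendsto_volume_smul_image_stretch_add (hK : IsCompact K) {p q : ℝ}
    (hp : 0 ≤ p) (hq : 0 ≤ q) :
    Tendsto (fun t : ℝ => t ^ Fintype.card {k // P k} *
        volume.real (p • (stretch P t '' K) + closedBall 0 q)) (𝓝[>] 0)
      (𝓝 (p ^ Fintype.card {k // P k} * volume.real (restrictCoords P '' K) *
        (q ^ Fintype.card {k // ¬ P k} *
          volume.real (ball (0 : EuclideanSpace ℝ {k // ¬ P k}) 1)))) := by
  obtain ⟨R, hR0, hR⟩ := hK.isBounded.exists_pos_norm_le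
  have hKP : IsCompact (p • (restrictCoords P '' K)) :=
    IsCompact.smul p (hK.image (continuous_restrictCoords P))
  have hvol : volume.real (p • (restrictCoords P '' K)) =
      p ^ Fintype.card {k // P k} * volume.real (restrictCoords P '' K) := by
    rw [measureReal_def, Measure.addHaar_smul_of_nonneg _ hp, ENNReal.toReal_mul,
      ENNReal.toReal_ofReal (by positivity), Module.finrank_fintype_fun_eq_card]
    rfl
  have h1 : Tendsto (fun t : ℝ => t * q) (𝓝[>] 0) (𝓝 0) := by
    have : Tendsto (fun t : ℝ => t * q) (𝓝 0) (𝓝 (0 * q)) := by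
      apply Continuous.tendsto; fun_prop
    rw [zero_mul] at this
    exact this.mono_left nhdsWithin_le_nhds
  -- The closed thickenings of a compact set have volume tending to that of the set.
  have h2 := ((ENNReal.tendsto_toReal hKP.measure_ne_top).comp
    (tendsto_measure_cthickening_of_isCompact (μ := volume) hKP)).comp h1
  have h3 : Tendsto (fun t : ℝ => (p * t * R + q) ^ Fintype.card {k // ¬ P k} *
      volume.real (ball (0 : EuclideanSpace ℝ {k // ¬ P k}) 1)) (𝓝[>] 0)
      (𝓝 (q ^ Fintype.card {k // ¬ P k} *
      volume.real (ball (0 : EuclideanSpace ℝ {k // ¬ P k}) 1))) := by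
    have : Tendsto (fun t : ℝ => (p * t * R + q) ^ Fintype.card {k // ¬ P k} *
      volume.real (ball (0 : EuclideanSpace ℝ {k // ¬ P k}) 1)) (𝓝 0)
      (𝓝 ((p * 0 * R + q) ^ Fintype.card {k // ¬ P k} *
      volume.real (ball (0 : EuclideanSpace ℝ {k // ¬ P k}) 1))) := by
      apply Continuous.tendsto (f := fun t : ℝ => (p * t * R + q) ^ Fintype.card {k // ¬ P k} *
        volume.real (ball (0 : EuclideanSpace ℝ {k // ¬ P k}) 1)); fun_prop
    rw [mul_zero, zero_mul, zero_add] at this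
    exact this.mono_left nhdsWithin_le_nhds
  have h4 := h2.mul h3
  rw [← measureReal_def, hvol] at h4
  refine tendsto_of_tendsto_of_tendsto_of_le_of_le' tendsto_const_nhds h4 ?_ ?_
  · filter_upwards [self_mem_nhdsWithin] with t ht
    exact le_volume_smul_image_stretch_add hK ht hp hq
  · filter_upwards [self_mem_nhdsWithin] with t ht
    exact volume_smul_image_stretch_add_le hK ht hp hq hR0.le hR

end SplitCoordinates

/-! ### Quermassintegrals degenerate to volumes of projections -/

theorem quermassintegral_eq_sum {n i : ℕ} (hin : i ≤ n) {K : Set (EuclideanSpace ℝ (Fin n))}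
    (hK : Convex ℝ K) (hK0 : K.Nonempty) :
    quermassintegral (n - i) K = (1 / (n.factorial : ℝ)) *
      ∑ S : Finset (Fin n), (-1 : ℝ) ^ (n - S.card) *
        volume.real (((S.filter fun k : Fin n => (k : ℕ) < i).card : ℝ) • K +
          closedBall 0 ((S.filter fun k : Fin n => ¬ (k : ℕ) < i).card : ℝ)) := by
  unfold quermassintegral mixedVolume
  rw [Nat.sub_sub_self hin]
  congr 1
  refine Finset.sum_congr rfl fun S _ => ?_
  rw [hK.sum_ite_eq_smul_add_smul (convex_closedBall _ _) hK0 ⟨0, by simp⟩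
    (fun k : Fin n => (k : ℕ) < i) S, smul_unitClosedBall_of_nonneg (Nat.cast_nonneg _)]

theorem tendsto_quermassintegral_stretch {n i : ℕ} (hin : i ≤ n)
    {K : Set (EuclideanSpace ℝ (Fin n))}
    (hK : Convex ℝ K) (hKc : IsCompact K) (hK0 : K.Nonempty) :
    Tendsto (fun t : ℝ => t ^ i *
        quermassintegral (n - i) (stretch (fun k : Fin n => (k : ℕ) < i) t '' K)) (𝓝[>] 0)
      (𝓝 (((i.factorial * (n - i).factorial : ℝ) / n.factorial *
        volume.real (ball (0 : EuclideanSpace ℝ {k : Fin n // ¬ (k : ℕ) < i}) 1)) *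
          volume.real (restrictCoords (fun k : Fin n => (k : ℕ) < i) '' K))) := by
  set P := fun k : Fin n => (k : ℕ) < i
  have hI : Fintype.card {k // P k} = i := Fintype.card_fin_lt_of_le hin
  have hJ : Fintype.card {k // ¬ P k} = n - i := by
    rw [Fintype.card_subtype_compl, hI, Fintype.card_fin]
  have hpol := sum_finset_neg_one_pow_mul_card_filter_pow P
  rw [Fintype.card_fin, hI, hJ] at hpol
  set ω := volume.real (ball (0 : EuclideanSpace ℝ {k : Fin n // ¬ P k}) 1)
  set v := volume.real (restrictCoords P '' K)
  have hlim : Tendsto (fun t : ℝ => (1 / (n.factorial : ℝ)) *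
      ∑ S : Finset (Fin n), (-1 : ℝ) ^ (n - S.card) * (t ^ i *
        volume.real (((S.filter P).card : ℝ) • (stretch P t '' K) +
          closedBall 0 ((S.filter fun k => ¬ P k).card : ℝ)))) (𝓝[>] 0)
      (𝓝 ((1 / (n.factorial : ℝ)) * ∑ S : Finset (Fin n), (-1 : ℝ) ^ (n - S.card) *
        (((S.filter P).card : ℝ) ^ i * v *
          (((S.filter fun k => ¬ P k).card : ℝ) ^ (n - i) * ω)))) := by
    refine (tendsto_finsetSum _ fun S _ => ?_).const_mul _
    have := tendsto_volume_smul_image_stretch_add (P := P) hKc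
      (Nat.cast_nonneg (S.filter P).card) (Nat.cast_nonneg (S.filter fun k => ¬ P k).card)
    rw [hI, hJ] at this
    exact this.const_mul _
  have hval : (1 / (n.factorial : ℝ)) * ∑ S : Finset (Fin n), (-1 : ℝ) ^ (n - S.card) *
        (((S.filter P).card : ℝ) ^ i * v *
          (((S.filter fun k => ¬ P k).card : ℝ) ^ (n - i) * ω)) =
      (i.factorial * (n - i).factorial : ℝ) / n.factorial * ω * v := by
    have hfac : ∑ S : Finset (Fin n), (-1 : ℝ) ^ (n - S.card) *
        (((S.filter P).card : ℝ) ^ i * v *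
          (((S.filter fun k => ¬ P k).card : ℝ) ^ (n - i) * ω)) =
        (i.factorial * (n - i).factorial : ℝ) * ω * v := by
      rw [← hpol, Finset.sum_mul, Finset.sum_mul]
      exact Finset.sum_congr rfl fun S _ => by ring
    rw [hfac]
    ring
  rw [hval] at hlim
  refine hlim.congr fun t => ?_
  rw [quermassintegral_eq_sum hin (hK.linear_image _) (hK0.image _), mul_left_comm,
    Finset.mul_sum (a := t ^ i)]
  congr 1
  exact Finset.sum_congr rfl fun S _ => mul_left_comm _ _ _

/-! ### Images of convex bodies under fractional linear maps -/

namespace FractionalLinearMap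

variable {n : ℕ}

/-- The composition `T ∘ F` with an injective linear map `T`. -/
noncomputable def postcomp (F : FractionalLinearMap n)
    (T : EuclideanSpace ℝ (Fin n) →ₗ[ℝ] EuclideanSpace ℝ (Fin n))
    (hT : Function.Injective T) : FractionalLinearMap n where
  linear := T ∘ₗ F.linear
  shift := T F.shift
  normal := F.normal
  const := F.const
  invertible := by
    have h : Function.Bijective T := ⟨hT, LinearMap.injective_iff_surjective.1 hT⟩
    convert! (h.prodMap Function.bijective_id).comp F.invertible using 2 with p
    simp

theorem postcomp_toFun (F : FractionalLinearMap n)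
    (T : EuclideanSpace ℝ (Fin n) →ₗ[ℝ] EuclideanSpace ℝ (Fin n))
    (hT : Function.Injective T) : (F.postcomp T hT).toFun = T ∘ F.toFun := by
  ext1 x
  simp [toFun, postcomp, denom]

theorem isCompact_image (F : FractionalLinearMap n) {K : Set (EuclideanSpace ℝ (Fin n))}
    (hK : IsCompact K) (h : K ⊆ F.Dom) : IsCompact (F.toFun '' K) := by
  refine hK.image_of_continuousOn ?_
  have h1 : Continuous F.denom := by unfold denom; fun_prop
  have h2 : Continuous F.linear := LinearMap.continuous_of_finiteDimensional _
  exact (h1.continuousOn.inv₀ fun x hx => (h hx).ne').smul (h2.add continuous_const).continuousOn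

theorem convex_image (F : FractionalLinearMap n) {K : Set (EuclideanSpace ℝ (Fin n))}
    (hK : Convex ℝ K) (h : K ⊆ F.Dom) : Convex ℝ (F.toFun '' K) := by
  rintro _ ⟨x, hx, rfl⟩ _ ⟨y, hy, rfl⟩ a b ha hb hab
  have hx0 : 0 < F.denom x := h hx
  have hy0 : 0 < F.denom y := h hy
  -- Weighting each point by the denominator at the other one makes the denominators cancel, so the
  -- image of the reweighted point is `a • F x + b • F y`.
  set α := a * F.denom y with hα
  set β := b * F.denom x with hβ
  have hs : 0 < α + β := by
    rcases ha.eq_or_lt with rfl | ha'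
    · have : b = 1 := by linarith
      rw [hα, hβ, this]; simpa using hx0
    · have : 0 < α := mul_pos ha' hy0
      have : 0 ≤ β := mul_nonneg hb hx0.le
      linarith
  have hsum : α / (α + β) + β / (α + β) = 1 := by field_simp
  refine ⟨(α / (α + β)) • x + (β / (α + β)) • y,
    hK hx hy (by positivity) (by positivity) hsum, ?_⟩
  have hden : F.denom ((α / (α + β)) • x + (β / (α + β)) • y) =
      F.denom x * F.denom y / (α + β) := by
    have : F.denom ((α / (α + β)) • x + (β / (α + β)) • y) =
        α / (α + β) * F.denom x + β / (α + β) * F.denom y := by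
      simp only [denom, inner_add_left, real_inner_smul_left]
      linear_combination -F.const * hsum
    rw [this, div_mul_eq_mul_div, div_mul_eq_mul_div, ← add_div]
    congr 1
    linear_combination F.denom x * F.denom y * hab
  have hnum : F.linear ((α / (α + β)) • x + (β / (α + β)) • y) + F.shift =
      (α / (α + β)) • (F.linear x + F.shift) + (β / (α + β)) • (F.linear y + F.shift) := by
    rw [map_add, map_smul, map_smul, smul_add, smul_add, add_add_add_comm, ← add_smul, hsum,
      one_smul]
  simp only [toFun]
  rw [hden, hnum, smul_add, smul_smul, smul_smul, smul_smul, smul_smul]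
  congr 2
  · generalize α + β = σ at hs
    rw [hα]
    field_simp
  · generalize α + β = σ at hs
    rw [hβ]
    field_simp

end FractionalLinearMap

/-! ### Comparison of projections -/

theorem volume_restrictCoords_image_le {n i : ℕ} (hin : i ≤ n)
    {A B : Set (EuclideanSpace ℝ (Fin n))}
    (hA : Convex ℝ A) (hAc : IsCompact A) (hA0 : A.Nonempty)
    (hB : Convex ℝ B) (hBc : IsCompact B) (hB0 : B.Nonempty)
    (h : ∀ F : FractionalLinearMap n, F.Admissible A B →
      quermassintegral (n - i) (F.toFun '' A) ≤ quermassintegral (n - i) (F.toFun '' B))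
    (F : FractionalLinearMap n) (hF : F.Admissible A B) :
    volume.real (restrictCoords (fun k : Fin n => (k : ℕ) < i) '' (F.toFun '' A)) ≤
      volume.real (restrictCoords (fun k : Fin n => (k : ℕ) < i) '' (F.toFun '' B)) := by
  have hlim := le_of_tendsto_of_tendsto
    (tendsto_quermassintegral_stretch hin (F.convex_image hA hF.1) (F.isCompact_image hAc hF.1)
      (hA0.image _))
    (tendsto_quermassintegral_stretch hin (F.convex_image hB hF.2) (F.isCompact_image hBc hF.2)
      (hB0.image _)) ?_
  · refine le_of_mul_le_mul_left hlim (mul_pos (by positivity) ?_)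
    exact ENNReal.toReal_pos (measure_ball_pos _ _ one_pos).ne' measure_ball_lt_top.ne
  · filter_upwards [self_mem_nhdsWithin] with t ht
    refine mul_le_mul_of_nonneg_left ?_ (pow_nonneg (le_of_lt ht) _)
    -- Post-composition leaves the denominator unchanged, so `hF` serves as the admissibility of the
    -- composed map.
    have := h (F.postcomp (stretch (fun k : Fin n => (k : ℕ) < i) t)
      (stretch_injective (ne_of_gt ht))) hF
    rwa [F.postcomp_toFun, Set.image_comp, Set.image_comp] at this

/-! ### Separation and the perspective map -/

/-- The unit normal of a separating hyperplane is completed to an orthonormal basis with index `k₀`,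
so separation is read off a single coordinate. -/
theorem exists_linearIsometryEquiv_separating {n : ℕ} (k₀ : Fin n)
    {B : Set (EuclideanSpace ℝ (Fin n))} (hB : Convex ℝ B) (hBc : IsClosed B) (hB0 : B.Nonempty)
    {a : EuclideanSpace ℝ (Fin n)} (ha : a ∉ B) :
    ∃ Φ : EuclideanSpace ℝ (Fin n) ≃ₗᵢ[ℝ] EuclideanSpace ℝ (Fin n), ∃ η > 0,
      ∀ b ∈ B, Φ a k₀ + η ≤ Φ b k₀ := by
  obtain ⟨f, u, hfa, hfb⟩ := geometric_hahn_banach_point_closed hB hBc ha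
  set c := (InnerProductSpace.toDual ℝ (EuclideanSpace ℝ (Fin n))).symm f with hc
  have hfc : ∀ x, inner ℝ c x = f x := fun x => by
    rw [hc, InnerProductSpace.toDual_symm_apply]
  have hc0 : 0 < ‖c‖ := by
    rw [norm_pos_iff]
    intro h0
    obtain ⟨b, hb⟩ := hB0
    have h1 := hfb b hb
    rw [← hfc, h0, inner_zero_left] at h1 hfa
    linarith
  have hv : Orthonormal ℝ (({k₀} : Set (Fin n)).domRestrict fun _ => ‖c‖⁻¹ • c) := by
    refine ⟨fun _ => ?_, fun i j hij => absurd (Subsingleton.elim i j) hij⟩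
    rw [Set.domRestrict_apply, norm_smul, norm_inv, norm_norm, inv_mul_cancel₀ hc0.ne']
  obtain ⟨b, hb⟩ := hv.exists_orthonormalBasis_extension_of_card_eq (by simp)
  have hbf : ∀ x, b.repr x k₀ = ‖c‖⁻¹ * f x := fun x => by
    rw [b.repr_apply_apply, hb k₀ rfl, real_inner_smul_left, hfc]
  refine ⟨b.repr, ‖c‖⁻¹ * (u - f a), mul_pos (by positivity) (by linarith), fun x hx => ?_⟩
  rw [hbf, hbf, ← mul_add]
  exact mul_le_mul_of_nonneg_left (by linarith [hfb x hx]) (by positivity)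

namespace FractionalLinearMap

variable {n : ℕ}

/-- The linear map that subtracts `y k₀ • w` from `y` and replaces the coordinate at `k₀` by
zero. -/
noncomputable def shear (k₀ : Fin n) (w : EuclideanSpace ℝ (Fin n)) :
    EuclideanSpace ℝ (Fin n) →ₗ[ℝ] EuclideanSpace ℝ (Fin n) where
  toFun y := WithLp.toLp 2 fun k => if k = k₀ then 0 else y k - y k₀ * w k
  map_add' x y := by
    ext k
    by_cases h : k = k₀
    · simp [h]
    · simp [h]; ring
  map_smul' r x := by
    ext k
    by_cases h : k = k₀
    · simp [h]
    · simp [h]; ring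

@[simp] theorem shear_apply (k₀ : Fin n) (w y : EuclideanSpace ℝ (Fin n)) (k : Fin n) :
    shear k₀ w y k = if k = k₀ then 0 else y k - y k₀ * w k := rfl

/-- In the coordinates `y = Φ (x - p)`, the map sending `y` to the vector with coordinates
`ε / (y k₀ + ε)` at `k₀` and `(y k - y k₀ * w k) / (y k₀ + ε)` elsewhere. -/
noncomputable def perspective (k₀ : Fin n)
    (Φ : EuclideanSpace ℝ (Fin n) ≃ₗᵢ[ℝ] EuclideanSpace ℝ (Fin n))
    (p w : EuclideanSpace ℝ (Fin n)) (ε : ℝ) (hε : ε ≠ 0) : FractionalLinearMap n where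
  linear := shear k₀ w ∘ₗ Φ.toLinearEquiv.toLinearMap
  shift := WithLp.toLp 2 fun k => if k = k₀ then ε else -(Φ p k - Φ p k₀ * w k)
  normal := Φ.symm (EuclideanSpace.single k₀ 1)
  const := ε - Φ p k₀
  invertible := by
    set A := shear k₀ w ∘ₗ Φ.toLinearEquiv.toLinearMap with hA
    set b : EuclideanSpace ℝ (Fin n) := WithLp.toLp 2 _
    set c := Φ.symm (EuclideanSpace.single k₀ 1) with hc
    let M : EuclideanSpace ℝ (Fin n) × ℝ →ₗ[ℝ] EuclideanSpace ℝ (Fin n) × ℝ :=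
      (A ∘ₗ LinearMap.fst ℝ _ _ + (LinearMap.snd ℝ _ _).smulRight b).prod
        (innerₛₗ ℝ c ∘ₗ LinearMap.fst ℝ _ _ + (ε - Φ p k₀) • LinearMap.snd ℝ _ _)
    have hM : ∀ z, M z = (A z.1 + z.2 • b, inner ℝ z.1 c + (ε - Φ p k₀) * z.2) := fun z => by
      simp [M, real_inner_comm]
    have hcx : ∀ x, inner ℝ x c = Φ x k₀ := fun x => by
      rw [hc, ← Φ.inner_map_map, Φ.apply_symm_apply, EuclideanSpace.inner_single_right]
      simp
    -- On the kernel, the `k₀` coordinate of the numerator is `s * ε`, so `s = 0`; the denominator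
    -- then kills `Φ x k₀`, and the remaining coordinates follow.
    have hinj : Function.Injective M := by
      refine (injective_iff_map_eq_zero M).2 ?_
      rintro ⟨x, s⟩ hz
      rw [hM, Prod.mk_eq_zero, hcx] at hz
      obtain ⟨h1, h2⟩ := hz
      have h3 : ∀ k, A x k + s * b k = 0 := fun k => by
        have := congrArg (fun y : EuclideanSpace ℝ (Fin n) => y k) h1
        simpa using this
      have hs : s = 0 := by
        have := h3 k₀
        simpa [A, b, hε] using this
      subst hs
      have hx0 : Φ x k₀ = 0 := by simpa using h2
      have hx : Φ x = 0 := by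
        ext k
        by_cases h : k = k₀
        · rw [h]; exact hx0
        · have := h3 k
          simpa [A, h, hx0] using this
      rw [Prod.mk_eq_zero]
      exact ⟨by simpa using hx, rfl⟩
    have hbij : Function.Bijective M := ⟨hinj, LinearMap.injective_iff_surjective.1 hinj⟩
    rwa [funext hM] at hbij

variable (k₀ : Fin n) (Φ : EuclideanSpace ℝ (Fin n) ≃ₗᵢ[ℝ] EuclideanSpace ℝ (Fin n))
  (p w : EuclideanSpace ℝ (Fin n)) (ε : ℝ) (hε : ε ≠ 0)

theorem perspective_denom (x : EuclideanSpace ℝ (Fin n)) :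
    (perspective k₀ Φ p w ε hε).denom x = Φ (x - p) k₀ + ε := by
  have : inner ℝ x (Φ.symm (EuclideanSpace.single k₀ 1)) = Φ x k₀ := by
    rw [← Φ.inner_map_map, Φ.apply_symm_apply, EuclideanSpace.inner_single_right]
    simp
  simp only [denom, perspective, this, map_sub, PiLp.sub_apply]
  ring

theorem perspective_toFun_apply (x : EuclideanSpace ℝ (Fin n)) (k : Fin n) :
    (perspective k₀ Φ p w ε hε).toFun x k = (Φ (x - p) k₀ + ε)⁻¹ *
      if k = k₀ then ε else Φ (x - p) k - Φ (x - p) k₀ * w k := by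
  rw [toFun, perspective_denom]
  by_cases h : k = k₀
  · simp [perspective, h]
  · simp [perspective, h]
    ring

end FractionalLinearMap

/-! ### Flattening `B` and blowing up `A` -/

section Perspective

open FractionalLinearMap

variable {n : ℕ} {P : Fin n → Prop} (k₀ : Fin n)
  {Φ : EuclideanSpace ℝ (Fin n) ≃ₗᵢ[ℝ] EuclideanSpace ℝ (Fin n)}
  {p : EuclideanSpace ℝ (Fin n)}

/-- Denominators on `B` are at least `η`, so the image lies in a box whose only side depending on
`ε` is the one at `k₀`. -/
theorem volume_perspective_image_le [DecidablePred P] {B : Set (EuclideanSpace ℝ (Fin n))}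
    {w : EuclideanSpace ℝ (Fin n)} {ε η C : ℝ}
    (hε : 0 < ε) (hη : 0 < η) (hC0 : 0 ≤ C) (hB : ∀ x ∈ B, η ≤ Φ (x - p) k₀)
    (hC : ∀ x ∈ B, ∀ k, |Φ (x - p) k - Φ (x - p) k₀ * w k| ≤ C) :
    volume.real (restrictCoords P '' ((perspective k₀ Φ p w ε hε.ne').toFun '' B)) ≤
      ∏ k : {k // P k}, if (k : Fin n) = k₀ then ε / η else 2 * C / η := by
  set lo : {k // P k} → ℝ := fun k => if (k : Fin n) = k₀ then 0 else -(C / η)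
  set hi : {k // P k} → ℝ := fun k => if (k : Fin n) = k₀ then ε / η else C / η
  have hle : lo ≤ hi := fun k => by
    simp only [lo, hi]
    split_ifs
    · positivity
    · exact neg_le_self (by positivity)
  have hsub : restrictCoords P '' ((perspective k₀ Φ p w ε hε.ne').toFun '' B) ⊆
      Set.Icc lo hi := by
    rintro _ ⟨_, ⟨x, hx, rfl⟩, rfl⟩
    have hy := hB x hx
    have hinv : (Φ (x - p) k₀ + ε)⁻¹ ≤ η⁻¹ := inv_anti₀ hη (by linarith)
    have hinv0 : 0 ≤ (Φ (x - p) k₀ + ε)⁻¹ := inv_nonneg.2 (by linarith)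
    have hcoord : ∀ k : {k // P k}, lo k ≤ (perspective k₀ Φ p w ε hε.ne').toFun x k ∧
        (perspective k₀ Φ p w ε hε.ne').toFun x k ≤ hi k := fun k => by
      rw [perspective_toFun_apply]
      simp only [lo, hi]
      split_ifs with h
      · exact ⟨by positivity, by
          rw [div_eq_inv_mul]; exact mul_le_mul_of_nonneg_right hinv hε.le⟩
      · rw [← abs_le, abs_mul, abs_of_nonneg hinv0, div_eq_inv_mul]
        exact mul_le_mul hinv (hC x hx k) (abs_nonneg _) (by positivity)
    exact ⟨fun k => (hcoord k).1, fun k => (hcoord k).2⟩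
  refine (measureReal_mono hsub isCompact_Icc.measure_ne_top).trans (le_of_eq ?_)
  rw [measureReal_def, Real.volume_Icc_pi_toReal hle]
  refine Finset.prod_congr rfl fun k _ => ?_
  simp only [lo, hi]
  split_ifs <;> ring

/-- By convexity `A` contains the cone with apex `p` over a cube around `q`. The choice of `w` sends
the axis from `p` to `q` into the `k₀` axis. Points at scale `s` of order `ε` on this cone have
images independent of `ε`, and these fill a fixed box. -/
theorem le_volume_perspective_image {A : Set (EuclideanSpace ℝ (Fin n))}
    [DecidablePred P] {q : EuclideanSpace ℝ (Fin n)} {ε δ : ℝ} (hA : Convex ℝ A)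
    (hAc : IsCompact A) (hp : p ∈ A) (hδ : 0 < δ)
    (hq : ∀ v : Fin n → ℝ, ‖v‖ ≤ δ → q + Φ.symm (WithLp.toLp 2 v) ∈ A)
    (hpA : ∀ x ∈ A, 0 ≤ Φ (x - p) k₀) (hh : 0 < Φ (q - p) k₀) (hε : 0 < ε)
    (hεh : 2 * ε ≤ Φ (q - p) k₀) :
    ∏ k : {k // P k}, (if (k : Fin n) = k₀ then 1 / 6 else δ / Φ (q - p) k₀) ≤
      volume.real (restrictCoords P '' ((perspective k₀ Φ p ((Φ (q - p) k₀)⁻¹ • Φ (q - p)) ε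
        hε.ne').toFun '' A)) := by
  set h := Φ (q - p) k₀ with hdef
  set w := h⁻¹ • Φ (q - p)
  set F := perspective k₀ Φ p w ε hε.ne' with hF
  set lo : {k // P k} → ℝ := fun k => if (k : Fin n) = k₀ then 1 / 3 else -(δ / (2 * h))
  set hi : {k // P k} → ℝ := fun k => if (k : Fin n) = k₀ then 1 / 2 else δ / (2 * h)
  have hle : lo ≤ hi := fun k => by
    simp only [lo, hi]
    split_ifs
    · norm_num
    · exact neg_le_self (by positivity)
  have hAF : A ⊆ F.Dom := fun x hx => by
    change 0 < F.denom x
    rw [hF, perspective_denom]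
    linarith [hpA x hx]
  have hsub : Set.Icc lo hi ⊆ restrictCoords P '' (F.toFun '' A) := by
    intro z hz
    have hbd : ∀ k, lo k ≤ z k ∧ z k ≤ hi k := fun k => ⟨hz.1 k, hz.2 k⟩
    -- `τ` is the target `k₀` coordinate. The bound `1 / 3 ≤ τ` together with `2 * ε ≤ h` gives `s ≤
    -- 1`, and `τ ≤ 1 / 2` gives `‖v‖ ≤ δ`. If `k₀` is not in `P`, any value in the range will do.
    obtain ⟨τ, hτ1, hτ2, hτ⟩ : ∃ τ : ℝ, 1 / 3 ≤ τ ∧ τ ≤ 1 / 2 ∧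
        ∀ k : {k // P k}, (k : Fin n) = k₀ → z k = τ := by
      by_cases hP : P k₀
      · have := hbd ⟨k₀, hP⟩
        simp only [lo, hi, if_true] at this
        refine ⟨z ⟨k₀, hP⟩, this.1, this.2, ?_⟩
        rintro ⟨k, hk⟩ rfl
        rfl
      · exact ⟨1 / 2, by norm_num, le_rfl, fun k hk => absurd (hk ▸ k.2) hP⟩
    have hτ0 : 0 < τ := by linarith
    have hτ' : 0 < 1 - τ := by linarith
    set v : Fin n → ℝ := fun k =>
      if hk : P k ∧ k ≠ k₀ then z ⟨k, hk.1⟩ * h / (1 - τ) else 0 with hv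
    have hvδ : ‖v‖ ≤ δ := by
      refine (pi_norm_le_iff_of_nonneg hδ.le).2 fun k => ?_
      simp only [hv]
      split_ifs with hk
      · have hzk := hbd ⟨k, hk.1⟩
        simp only [lo, hi, if_neg hk.2] at hzk
        rw [Real.norm_eq_abs, abs_div, abs_mul, abs_of_pos hh, abs_of_pos hτ',
          div_le_iff₀ hτ']
        have h1 := mul_le_mul_of_nonneg_right (abs_le.2 hzk) hh.le
        have h2 : δ / (2 * h) * h = δ * (1 / 2) := by field_simp
        rw [h2] at h1
        refine h1.trans (mul_le_mul_of_nonneg_left (by linarith) hδ.le)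
      · simpa using hδ.le
    -- Solves `ε / (s * h + ε) = τ`; then `v` is forced by the remaining coordinates of `z`.
    set s := ε * (1 - τ) / (τ * h) with hs
    have hs1 : s ≤ 1 := by
      rw [hs, div_le_one (by positivity)]
      nlinarith [mul_le_mul_of_nonneg_left hεh hτ0.le]
    set x := p + s • (q + Φ.symm (WithLp.toLp 2 v) - p) with hx
    have hxA : x ∈ A := hA.add_smul_sub_mem hp (hq v hvδ) ⟨by positivity, hs1⟩
    have hΦ : Φ (x - p) = s • (Φ (q - p) + WithLp.toLp 2 v) := by
      rw [hx, add_sub_cancel_left, map_smul, add_sub_right_comm, map_add, Φ.apply_symm_apply]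
    have hv0 : v k₀ = 0 := by simp [hv]
    have hΦ0 : Φ (x - p) k₀ = s * h := by
      rw [hΦ, PiLp.smul_apply, PiLp.add_apply, ← hdef]
      simp [hv0]
    have hden : Φ (x - p) k₀ + ε = ε / τ := by
      rw [hΦ0, hs]
      field_simp
      ring
    refine ⟨_, ⟨x, hxA, rfl⟩, ?_⟩
    ext k
    rw [restrictCoords, hF, perspective_toFun_apply, hden]
    split_ifs with hk
    · rw [hτ k hk]
      field_simp
    · have hnum : Φ (x - p) k - Φ (x - p) k₀ * w k = s * (z k * h / (1 - τ)) := by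
        rw [hΦ0, hΦ]
        simp only [w, PiLp.smul_apply, PiLp.add_apply, smul_eq_mul, hv, ne_eq, hk, k.2,
          not_false_eq_true, and_self, dite_true]
        field_simp
        ring
      rw [hnum, hs]
      field_simp
  refine le_trans (le_of_eq ?_) (measureReal_mono hsub
    ((F.isCompact_image hAc hAF).image (continuous_restrictCoords P)).measure_ne_top)
  rw [measureReal_def, Real.volume_Icc_pi_toReal hle]
  refine Finset.prod_congr rfl fun k _ => ?_
  simp only [lo, hi]
  split_ifs
  · norm_num
  · field_simp; norm_num

end Perspective

/-! ### Choice of constants and conclusion -/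

theorem exists_pi_ball_subset {n : ℕ} {A : Set (EuclideanSpace ℝ (Fin n))}
    {q : EuclideanSpace ℝ (Fin n)} (hq : q ∈ interior A)
    (Φ : EuclideanSpace ℝ (Fin n) ≃ₗᵢ[ℝ] EuclideanSpace ℝ (Fin n)) :
    ∃ δ > 0, ∀ v : Fin n → ℝ, ‖v‖ ≤ δ → q + Φ.symm (WithLp.toLp 2 v) ∈ A := by
  have hcont : Continuous fun v : Fin n → ℝ => q + Φ.symm (WithLp.toLp 2 v) := by fun_prop
  have hnhds : (fun v : Fin n → ℝ => q + Φ.symm (WithLp.toLp 2 v)) ⁻¹' A ∈ 𝓝 0 := by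
    refine hcont.continuousAt.preimage_mem_nhds ?_
    simpa using mem_interior_iff_mem_nhds.1 hq
  obtain ⟨δ, hδ, hsub⟩ := nhds_basis_closedBall.mem_iff.1 hnhds
  exact ⟨δ, hδ, fun v hv => hsub (mem_closedBall_zero_iff.2 hv)⟩

theorem exists_perspective_bound {n : ℕ} {B : Set (EuclideanSpace ℝ (Fin n))} (hB : IsCompact B)
    (k₀ : Fin n) (Φ : EuclideanSpace ℝ (Fin n) ≃ₗᵢ[ℝ] EuclideanSpace ℝ (Fin n))
    (p w : EuclideanSpace ℝ (Fin n)) :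
    ∃ C, 0 ≤ C ∧ ∀ x ∈ B, ∀ k, |Φ (x - p) k - Φ (x - p) k₀ * w k| ≤ C := by
  have hcont : Continuous fun x => Φ (x - p) - Φ (x - p) k₀ • w := by fun_prop
  obtain ⟨C, hC⟩ := hB.exists_bound_of_continuousOn hcont.continuousOn
  refine ⟨max C 0, le_max_right _ _, fun x hx k => ?_⟩
  exact ((PiLp.norm_apply_le (Φ (x - p) - Φ (x - p) k₀ • w) k).trans (hC x hx)).trans
    (le_max_left _ _)

theorem theorem2 (n : ℕ) (hn : 2 ≤ n) (i : ℕ) (hi1 : 1 ≤ i) (hin : i ≤ n)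
    (A B : ConvexBody (EuclideanSpace ℝ (Fin n)))
    (hA : (interior (A : Set (EuclideanSpace ℝ (Fin n)))).Nonempty)
    (hB : (interior (B : Set (EuclideanSpace ℝ (Fin n)))).Nonempty)
    (h : ∀ F : FractionalLinearMap n,
      F.Admissible (A : Set (EuclideanSpace ℝ (Fin n))) (B : Set (EuclideanSpace ℝ (Fin n))) →
      quermassintegral (n - i) (F.toFun '' (A : Set (EuclideanSpace ℝ (Fin n)))) ≤
        quermassintegral (n - i) (F.toFun '' (B : Set (EuclideanSpace ℝ (Fin n))))) :
    (A : Set (EuclideanSpace ℝ (Fin n))) ⊆ (B : Set (EuclideanSpace ℝ (Fin n))) := by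
  intro a ha
  by_contra haB
  set k₀ : Fin n := ⟨0, by omega⟩
  set P := fun k : Fin n => (k : ℕ) < i
  obtain ⟨Φ, η, hη, hsep⟩ :=
    exists_linearIsometryEquiv_separating k₀ B.convex B.isCompact.isClosed B.nonempty haB
  obtain ⟨p, hpA, hpmin⟩ := A.isCompact.exists_isMinOn ⟨a, ha⟩
    (f := fun x => Φ x k₀) (by fun_prop : Continuous fun x => Φ x k₀).continuousOn
  have hA0 : ∀ x ∈ (A : Set (EuclideanSpace ℝ (Fin n))), 0 ≤ Φ (x - p) k₀ := fun x hx => by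
    rw [map_sub, PiLp.sub_apply, sub_nonneg]
    exact hpmin hx
  have hBη : ∀ x ∈ (B : Set (EuclideanSpace ℝ (Fin n))), η ≤ Φ (x - p) k₀ := fun x hx => by
    have h1 : Φ p k₀ ≤ Φ a k₀ := hpmin ha
    have h2 := hsep x hx
    rw [map_sub, PiLp.sub_apply]
    linarith
  obtain ⟨q, hq⟩ := hA
  obtain ⟨δ, hδ, hball⟩ := exists_pi_ball_subset hq Φ
  have hh : 0 < Φ (q - p) k₀ := by
    -- Moving from the interior point `q` down by `δ` stays in `A`, hence not below `p`; so `q` has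
    -- height at least `δ`.
    have h1 := hA0 _ (hball (Pi.single k₀ (-δ)) (by simp [Pi.norm_single, abs_of_pos hδ]))
    rw [add_sub_right_comm, map_add, Φ.apply_symm_apply, PiLp.add_apply] at h1
    simp only [Pi.single_eq_same] at h1
    linarith
  set w := (Φ (q - p) k₀)⁻¹ • Φ (q - p)
  obtain ⟨C, hC0, hC⟩ := exists_perspective_bound B.isCompact k₀ Φ p w
  set c := ∏ k : {k // P k}, (if (k : Fin n) = k₀ then 1 / 6 else δ / Φ (q - p) k₀)
  have hc : 0 < c := Finset.prod_pos fun k _ => by split_ifs <;> positivity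
  have hlim : Tendsto (fun ε : ℝ => ∏ k : {k // P k},
      if (k : Fin n) = k₀ then ε / η else 2 * C / η) (𝓝[>] 0) (𝓝 0) := by
    have hcont : Continuous fun ε : ℝ => ∏ k : {k // P k},
        if (k : Fin n) = k₀ then ε / η else 2 * C / η :=
      continuous_finsetProd _ fun k _ => by split_ifs <;> fun_prop
    have h0 := hcont.tendsto 0
    -- Since `1 ≤ i`, the index `k₀` is among the projected coordinates, so the factor `ε / η`
    -- occurs in the product.
    rw [Finset.prod_eq_zero (Finset.mem_univ (⟨k₀, hi1⟩ : {k // P k})) (by simp)] at h0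
    exact h0.mono_left nhdsWithin_le_nhds
  have hsmall : ∀ᶠ ε in 𝓝[>] (0 : ℝ), ε < Φ (q - p) k₀ / 2 :=
    (eventually_lt_nhds (half_pos hh)).filter_mono nhdsWithin_le_nhds
  obtain ⟨ε, hεc, hεh, hε⟩ :=
    ((hlim.eventually_lt_const hc).and (hsmall.and self_mem_nhdsWithin)).exists
  replace hε : 0 < ε := hε
  set F := FractionalLinearMap.perspective k₀ Φ p w ε hε.ne'
  have hF : F.Admissible A B := by
    refine ⟨fun x hx => ?_, fun x hx => ?_⟩ <;> change 0 < F.denom x <;>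
      rw [FractionalLinearMap.perspective_denom]
    · linarith [hA0 x hx]
    · linarith [hBη x hx]
  have h1 := volume_restrictCoords_image_le hin A.convex A.isCompact A.nonempty
    B.convex B.isCompact B.nonempty h F hF
  have h2 := volume_perspective_image_le (P := P) k₀ hε hη hC0 hBη hC
  have h3 := le_volume_perspective_image (P := P) k₀ A.convex A.isCompact hpA hδ hball hA0 hh hε
    (by linarith)
  exact absurd (h3.trans (h1.trans h2)) (not_le.2 hεc)
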